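/- Let $G$ be a finite graph, with loops and multiple edges allowed, with vertex set $V$ and edge set $E$, and fix a reference orientation of its edges. Let $\mathcal F(G)\subset\mathbb Z^{E}$ be the lattice of integer flows of $G$, with the Euclidean inner product $(\cdot,\cdot)$ of $\mathbb R^{E}$, and let $V(G)$ be its Voronoi cell, i.e. the set of points of the real span $\mathcal F(G)\otimes\mathbb R\subset\mathbb R^{E}$ that are at least as close to the origin as to every other point of $\mathcal F(G)$. Let $\mathcal V(G)$ be the poset of nonempty faces of $V(G)$ (including $V(G)$ itself), ordered by inclusion. Let $\mathcal S(G)$ be the set of pairs $(H,\omega_H)$, where $H$ is a spanning subgraph of $G$ (given by a subset of $E$) and $\omega_H$ is an orientation of $H$ that is strongly connected on every connected component of $H$, ordered by $(H,\omega_H)\preceq(H',\omega'_{H'})$ iff $H'\subseteq H$ and $\omega'_{H'}$ is the restriction of $\omega_H$. An oriented circuit $C$ is given by a closed walk of positive length which returns neither to a vertex nor to an edge twice; it is regarded both as an element of $\mathcal F(G)$ (with coefficients $0,\pm1$) and as an element of $\mathcal S(G)$, and $F_C=\{x\in V(G) : (x,C)=(C,C)/2\}$ is the face of $V(G)$ that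 it defines. There is a unique isomorphism of posets $\Phi:\mathcal V(G)\to\mathcal S(G)$ (Amini's isomorphism) such that the codimension of every face $F$ in $V(G)$ is the genus (rank of the group of integer flows) of the subgraph in $\Phi(F)$, and such that $\Phi(F_C)$ is $C$ with its cyclic orientation for every oriented circuit $C$ (so that the $F_C$ have codimension one). Moreover, let $F$ be a face of $V(G)$ expressed as an intersection $$F=F_{C_1}\cap F_{C_2}\cap\dots\cap F_{C_s}$$ for oriented circuits $C_1,\dots,C_s$. Then the orientations of these circuits are compatible, i.e. any two of them agree on their common edges, and $\Phi(F)$ is the subgraph $C_1\cup C_2\cup\dots\cup C_s$ with the induced orientation, i.e. the orientation that restricts to the given one on each $C_i$. -/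

import Mathlib

/-- A multigraph with vertex set `V` and edge set `E`, together with a reference orientation:
`e` runs from `src e` to `tgt e`. Loops and multiple edges are allowed. -/
structure OrientedMultigraph (V E : Type*) where
  src : E → V
  tgt : E → V

namespace OrientedMultigraph

variable {V E : Type*}

/-- A (spanning) subgraph `H` of `G` together with an orientation of `H` is recorded by a sign
vector `σ : E → SignType`: the edges of `H` are those with `σ e ≠ 0`, and such an edge is oriented
along its reference direction if `σ e = 1` and against it if `σ e = -1`. (In particular a loop has
two orientations.) `G.Arc σ e u v` says that `e` is an edge of `H` oriented from `u` to `v`. -/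
def Arc (G : OrientedMultigraph V E) (σ : E → SignType) (e : E) (u v : V) : Prop :=
  (σ e = 1 ∧ G.src e = u ∧ G.tgt e = v) ∨ (σ e = -1 ∧ G.tgt e = u ∧ G.src e = v)

/-- The oriented subgraph `σ` is strongly connected on each connected component: any two vertices
joined by an undirected walk are joined by a directed one. -/
def IsStronglyConnected (G : OrientedMultigraph V E) (σ : E → SignType) : Prop :=
  ∀ u v : V, Relation.EqvGen (fun a b => ∃ e, G.Arc σ e a b) u v →
    Relation.ReflTransGen (fun a b => ∃ e, G.Arc σ e a b) u v

/-- The set of pairs `(H, ω)`, where `H` is a subgraph of `G` and `ω` is a strongly connected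
orientation of `H`. -/
@[ext] structure StrongOrientation (G : OrientedMultigraph V E) where
  dir : E → SignType
  strong : G.IsStronglyConnected dir

/-- `(H, ω) ≤ (H', ω')` if `H'` is a subgraph of `H` and `ω'` is the restriction of `ω` to `H'`. -/
instance (G : OrientedMultigraph V E) : PartialOrder (StrongOrientation G) where
  le σ τ := ∀ e, τ.dir e ≠ 0 → σ.dir e = τ.dir e
  le_refl _ _ _ := rfl
  le_trans σ τ ρ h₁ h₂ e he :=
    (h₁ e (by rw [h₂ e he]; exact he)).trans (h₂ e he)
  le_antisymm σ τ h₁ h₂ := by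
    ext1
    funext e
    by_cases h : τ.dir e = 0
    · by_cases h' : σ.dir e = 0
      · rw [h, h']
      · exact (h₂ e h').symm
    · exact h₁ e h

/-- The oriented subgraph `σ` is a circuit with a cyclic orientation: its edges are those of a
closed walk of length `n + 1 ≥ 1` that does not return to the same vertex or to the same edge,
oriented along the walk. (Addition in `Fin (n + 1)` is cyclic.) -/
def IsOrientedCircuit (G : OrientedMultigraph V E) (σ : E → SignType) : Prop :=
  ∃ (n : ℕ) (vertex : Fin (n + 1) → V) (edge : Fin (n + 1) → E),
    Function.Injective vertex ∧ Function.Injective edge ∧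
    (∀ e, σ e ≠ 0 ↔ e ∈ Set.range edge) ∧
    ∀ i, G.Arc σ (edge i) (vertex i) (vertex (i + 1))

/-- Oriented circuits of `G`. -/
structure OrientedCircuit (G : OrientedMultigraph V E) where
  dir : E → SignType
  isCircuit : G.IsOrientedCircuit dir

/-- Two oriented circuits are compatible if they agree on their common edges. -/
def OrientedCircuit.Compatible {G : OrientedMultigraph V E} (C D : OrientedCircuit G) : Prop :=
  ∀ e, C.dir e ≠ 0 → D.dir e ≠ 0 → C.dir e = D.dir e

/-- The edges of an oriented circuit. -/
def OrientedCircuit.edges {G : OrientedMultigraph V E} (C : OrientedCircuit G) : Set E :=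
  {e | C.dir e ≠ 0}

/-- The edges of the subgraph `H` of a pair `(H, ω)`. -/
def StrongOrientation.edges {G : OrientedMultigraph V E} (σ : StrongOrientation G) : Set E :=
  {e | σ.dir e ≠ 0}

section Flows

variable [DecidableEq V] [Fintype E]

/-- The lattice of integer flows, a subgroup of `ℤ^E`. -/
def intFlows (G : OrientedMultigraph V E) : Submodule ℤ (E → ℤ) where
  carrier := {a | ∀ v, (∑ e, if G.tgt e = v then a e else 0) -
    (∑ e, if G.src e = v then a e else 0) = 0}
  zero_mem' := by simp
  add_mem' := by
    intro a b ha hb v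
    have key : ∀ f : E → V, (∑ e, if f e = v then (a + b) e else 0) =
        (∑ e, if f e = v then a e else 0) + ∑ e, if f e = v then b e else 0 := by
      intro f
      rw [← Finset.sum_add_distrib]
      refine Finset.sum_congr rfl fun e _ => ?_
      split_ifs <;> simp
    have h₁ := ha v
    have h₂ := hb v
    rw [key, key]
    linarith
  smul_mem' := by
    intro c a ha v
    have key : ∀ f : E → V, (∑ e, if f e = v then (c • a) e else 0) =
        c * ∑ e, if f e = v then a e else 0 := by
      intro f
      rw [Finset.mul_sum]
      refine Finset.sum_congr rfl fun e _ => ?_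
      split_ifs <;> simp
    rw [key, key, ← mul_sub, ha v, mul_zero]

/-- The integer flows of the subgraph `H` of a pair `(H, ω)`. -/
def StrongOrientation.flows {G : OrientedMultigraph V E} (σ : StrongOrientation G) :
    Submodule ℤ (E → ℤ) where
  carrier := {a | a ∈ G.intFlows ∧ ∀ e, e ∉ σ.edges → a e = 0}
  zero_mem' := ⟨zero_mem _, fun _ _ => rfl⟩
  add_mem' := fun ha hb => ⟨add_mem ha.1 hb.1, fun e he => by simp [ha.2 e he, hb.2 e he]⟩
  smul_mem' := fun c _ ha => ⟨Submodule.smul_mem _ c ha.1, fun e he => by simp [ha.2 e he]⟩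

/-- The genus of the subgraph `H` of a pair `(H, ω)`: the rank of its group of integer flows. -/
noncomputable def StrongOrientation.genus {G : OrientedMultigraph V E}
    (σ : StrongOrientation G) : ℕ :=
  Module.finrank ℤ σ.flows

/-- An integer vector, seen in Euclidean space. -/
noncomputable def toEuclidean (a : E → ℤ) : EuclideanSpace ℝ E :=
  WithLp.toLp 2 fun e => (a e : ℝ)

/-- The real vector space generated by the lattice of integer flows. -/
noncomputable def flowSpace (G : OrientedMultigraph V E) : Submodule ℝ (EuclideanSpace ℝ E) :=
  Submodule.span ℝ (toEuclidean '' (G.intFlows : Set (E → ℤ)))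

/-- The Voronoi cell of the lattice of integer flows. -/
def voronoiCell (G : OrientedMultigraph V E) : Set (EuclideanSpace ℝ E) :=
  {x | x ∈ G.flowSpace ∧ ∀ a ∈ G.intFlows, dist x 0 ≤ dist x (toEuclidean a)}

/-- The nonempty faces of the Voronoi cell (the cell itself included), ordered by inclusion. -/
abbrev VoronoiFace (G : OrientedMultigraph V E) :=
  {F : Set (EuclideanSpace ℝ E) // F.Nonempty ∧ IsExposed ℝ G.voronoiCell F}

/-- The codimension of a face in the Voronoi cell. -/
noncomputable def faceCodim {G : OrientedMultigraph V E} (F : VoronoiFace G) : ℕ :=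
  Module.finrank ℝ G.flowSpace - Module.finrank ℝ (vectorSpan ℝ F.1)

/-- The element of `ℤ^E` given by an oriented circuit. -/
def OrientedCircuit.vec {G : OrientedMultigraph V E} (C : OrientedCircuit G) : E → ℤ :=
  fun e => (C.dir e : ℤ)

theorem OrientedCircuit.vec_mem {G : OrientedMultigraph V E} (C : OrientedCircuit G) :
    C.vec ∈ G.intFlows := by
  classical
  obtain ⟨n, vertex, edge, -, hedge, hsupp, harc⟩ := C.isCircuit
  intro v
  rw [← Finset.sum_sub_distrib]
  have h0 : ∀ e ∉ Finset.univ.image edge,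
      ((if G.tgt e = v then C.vec e else 0) - if G.src e = v then C.vec e else 0) = 0 := by
    intro e he
    have : C.dir e = 0 := by
      by_contra h
      obtain ⟨i, hi⟩ := (hsupp e).1 h
      exact he (Finset.mem_image.2 ⟨i, Finset.mem_univ _, hi⟩)
    simp [OrientedCircuit.vec, this]
  rw [← Finset.sum_subset (Finset.subset_univ (Finset.univ.image edge)) fun e _ he => h0 e he,
    Finset.sum_image fun _ _ _ _ h => hedge h]
  have h1 : ∀ i, ((if G.tgt (edge i) = v then C.vec (edge i) else 0) -
      if G.src (edge i) = v then C.vec (edge i) else 0) =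
      (if vertex (i + 1) = v then (1 : ℤ) else 0) - if vertex i = v then 1 else 0 := by
    intro i
    rcases harc i with ⟨h, hs, ht⟩ | ⟨h, hs, ht⟩
    · simp [OrientedCircuit.vec, h, hs, ht]
    · simp only [OrientedCircuit.vec, h, hs, ht]
      split_ifs <;> simp
  rw [Finset.sum_congr rfl fun i _ => h1 i, Finset.sum_sub_distrib, sub_eq_zero]
  exact Equiv.sum_comp (Equiv.addRight (1 : Fin (n + 1))) (fun i => if vertex i = v then (1 : ℤ) else 0)

/-- The intersection of the Voronoi cell with the perpendicular bisector of the circuit `C`. -/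
def OrientedCircuit.facetSet {G : OrientedMultigraph V E} (C : OrientedCircuit G) :
    Set (EuclideanSpace ℝ E) :=
  {x | x ∈ G.voronoiCell ∧
    inner ℝ x (toEuclidean C.vec) = inner ℝ (toEuclidean C.vec) (toEuclidean C.vec) / 2}

theorem dist_zero_le_iff (x y : EuclideanSpace ℝ E) :
    dist x 0 ≤ dist x y ↔ inner ℝ x y ≤ inner ℝ y y / 2 := by
  rw [dist_zero_right, dist_eq_norm, ← sq_le_sq₀ (norm_nonneg _) (norm_nonneg _),
    norm_sub_sq_real, real_inner_self_eq_norm_sq]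
  constructor <;> intro h <;> linarith

theorem OrientedCircuit.half_mem {G : OrientedMultigraph V E} (C : OrientedCircuit G) :
    (2⁻¹ : ℝ) • toEuclidean C.vec ∈ G.voronoiCell := by
  refine ⟨Submodule.smul_mem _ _ (Submodule.subset_span ⟨_, C.vec_mem, rfl⟩), fun a _ => ?_⟩
  rw [dist_zero_le_iff, real_inner_smul_left]
  have : inner ℝ (toEuclidean C.vec) (toEuclidean a) ≤ inner ℝ (toEuclidean a) (toEuclidean a) := by
    simp only [PiLp.inner_apply, toEuclidean, RCLike.inner_apply, conj_trivial]
    refine Finset.sum_le_sum fun e _ => ?_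
    have h : a e * C.vec e ≤ a e * a e := by
      have hv : C.vec e = 0 ∨ C.vec e = -1 ∨ C.vec e = 1 := by
        unfold OrientedCircuit.vec
        cases C.dir e <;> simp
      rcases hv with hv | hv | hv <;> rw [hv]
      · nlinarith [mul_self_nonneg (a e)]
      · rcases le_or_gt 0 (a e) with h | h <;> nlinarith
      · rcases le_or_gt (a e) 0 with h | h <;> nlinarith
    exact_mod_cast h
  linarith

/-- The face `F_C` of the Voronoi cell defined by an oriented circuit `C`. -/
def OrientedCircuit.facet {G : OrientedMultigraph V E} (C : OrientedCircuit G) : VoronoiFace G :=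
  ⟨C.facetSet, by
    have hmem : (2⁻¹ : ℝ) • toEuclidean C.vec ∈ C.facetSet :=
      ⟨C.half_mem, by rw [real_inner_smul_left]; ring⟩
    refine ⟨⟨_, hmem⟩, fun _ => ⟨innerSL ℝ (toEuclidean C.vec), ?_⟩⟩
    have hle : ∀ y ∈ G.voronoiCell, inner ℝ y (toEuclidean C.vec) ≤
        inner ℝ (toEuclidean C.vec) (toEuclidean C.vec) / 2 :=
      fun y hy => (dist_zero_le_iff _ _).1 (hy.2 _ C.vec_mem)
    ext x
    simp only [innerSL_apply_apply, Set.mem_ofPred_eq]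
    constructor
    · rintro ⟨hx, h⟩
      refine ⟨hx, fun y hy => ?_⟩
      rw [real_inner_comm, real_inner_comm x, h]
      exact hle y hy
    · rintro ⟨hx, h⟩
      refine ⟨hx, le_antisymm (hle x hx) ?_⟩
      have := h _ C.half_mem
      rw [real_inner_smul_right, real_inner_comm x] at this
      linarith⟩

/-- `Φ` is Amini's isomorphism: an isomorphism from the poset of faces of the Voronoi cell to the
poset of strongly connected orientations of subgraphs, such that the codimension of a face is the
genus of the corresponding subgraph, and the face `F_C` of an oriented circuit `C` corresponds
to `C` with its cyclic orientation. -/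
def IsAminiIso {G : OrientedMultigraph V E} (Φ : VoronoiFace G ≃o StrongOrientation G) : Prop :=
  (∀ F, faceCodim F = (Φ F).genus) ∧ ∀ C : OrientedCircuit G, (Φ C.facet).dir = C.dir

end Flows

end OrientedMultigraph

/-!
Every real flow is a nonnegative combination of oriented circuits that conform to it, i.e. that run
along its support in the direction of its signs. Hence the inequalities `(x, C) ≤ (C, C) / 2` of the
circuits already cut out the Voronoi cell, and its support function at a flow `a` is `‖a‖₁ / 2`. So
the cell is a zonotope, the projection of the cube `[-1/2, 1/2]^E` to the flow space. The faces of
such a projection are the images of the faces of the cube given by the sign vectors of flows, and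
a sign vector comes from a flow exactly if it is a strongly connected orientation. In the resulting
isomorphism `F_C` corresponds to `C`.

A strongly connected orientation is the union of the circuits that conform to it. In the poset it is
therefore determined by the circuits above it, which gives uniqueness; and an intersection of facets
`F_C` is an infimum of faces, which corresponds to the infimum, i.e. the union, of the circuits.
-/

section Zonotopes

variable {E : Type*}

/-- The sign vector `σ` conforms to `τ` if it is obtained from `τ` by replacing some entries
by `0`. This is the order on the covectors of an oriented matroid; for faces of a cube it is reverse
inclusion, and for oriented subgraphs it says that `σ` is a subgraph of `τ` with the restricted
orientation. -/
def Conforms (σ τ : E → SignType) : Prop :=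
  ∀ e, σ e ≠ 0 → τ e = σ e

theorem Conforms.ne_zero {σ τ : E → SignType} (h : Conforms σ τ) {e : E} (he : σ e ≠ 0) :
    τ e ≠ 0 := by
  rwa [h e he]

theorem Conforms.trans {σ τ ρ : E → SignType} (hστ : Conforms σ τ) (hτρ : Conforms τ ρ) :
    Conforms σ ρ := fun e he =>
  (hτρ e (hστ.ne_zero he)).trans (hστ e he)

theorem conforms_indicator (S : Set E) (σ : E → SignType) : Conforms (S.indicator σ) σ :=
  fun _ he => (Set.indicator_of_mem (Set.mem_of_indicator_ne_zero he) σ).symm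

/-- The sign vector of a real vector, the coordinatewise sign. -/
noncomputable def signVector (a : EuclideanSpace ℝ E) : E → SignType :=
  fun e => SignType.sign (a e)

theorem signVector_ne_zero_iff {a : EuclideanSpace ℝ E} {e : E} : signVector a e ≠ 0 ↔ a e ≠ 0 :=
  sign_ne_zero

theorem sign_signType_cast (s : SignType) : SignType.sign (s : ℝ) = s := by
  cases s <;> simp

theorem signVector_sum_eq {ι : Type*} {s : Finset ι} {a : ι → EuclideanSpace ℝ E}
    {σ : E → SignType} (hconf : ∀ i ∈ s, Conforms (signVector (a i)) σ)
    (hcover : ∀ e, σ e ≠ 0 → ∃ i ∈ s, a i e ≠ 0) : signVector (∑ i ∈ s, a i) = σ := by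
  funext e
  have hsum : (∑ i ∈ s, a i) e = (σ e : ℝ) * ∑ i ∈ s, |a i e| := by
    rw [WithLp.ofLp_sum, Finset.sum_apply, Finset.mul_sum]
    refine Finset.sum_congr rfl fun i hi => ?_
    by_cases h : a i e = 0
    · rw [h, abs_zero, mul_zero]
    · rw [hconf i hi e (signVector_ne_zero_iff.2 h), signVector, sign_mul_abs]
  rw [signVector, hsum]
  by_cases h : σ e = 0
  · simp [h]
  · obtain ⟨i, hi, hne⟩ := hcover e h
    have hpos : 0 < ∑ i ∈ s, |a i e| :=
      Finset.sum_pos' (fun _ _ => abs_nonneg _) ⟨i, hi, abs_pos.2 hne⟩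
    rw [sign_mul, sign_pos hpos, mul_one, sign_signType_cast]

theorem exists_sub_smul_conforms [Finite E] {a b : EuclideanSpace ℝ E}
    (hab : Conforms (signVector a) (signVector b)) (ha : a ≠ 0) :
    ∃ c : ℝ, 0 ≤ c ∧ Conforms (signVector (b - c • a)) (signVector b) ∧
      ∃ e, b e ≠ 0 ∧ (b - c • a) e = 0 := by
  have hne : {e | a e ≠ 0}.Nonempty := by
    by_contra! h
    exact ha (PiLp.ext fun e => not_not.1 (Set.eq_empty_iff_forall_notMem.1 h e))
  obtain ⟨e₀, he₀, hmin⟩ :=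
    Set.exists_min_image {e | a e ≠ 0} (fun e => |b e| / |a e|) (Set.toFinite _) hne
  set c := |b e₀| / |a e₀| with hc
  have hle (e : E) : c * |a e| ≤ |b e| := by
    by_cases he : a e = 0
    · rw [he, abs_zero, mul_zero]
      exact abs_nonneg _
    · exact (le_div_iff₀ (abs_pos.2 he)).1 (hmin e he)
  have sub_apply (e : E) : (b - c • a) e = (|b e| - c * |a e|) * SignType.sign (b e) := by
    rw [PiLp.sub_apply, PiLp.smul_apply, smul_eq_mul, sub_mul, abs_mul_sign, mul_assoc]
    by_cases he : a e = 0
    · rw [he, abs_zero, zero_mul]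
    · rw [show SignType.sign (b e) = SignType.sign (a e) from
        hab e (signVector_ne_zero_iff.2 he),
        abs_mul_sign]
  refine ⟨c, by positivity, fun e he => ?_, e₀, ?_, ?_⟩
  · simp only [signVector, sub_apply, sign_mul, sign_signType_cast] at he ⊢
    have hpos : 0 < |b e| - c * |a e| :=
      (sub_nonneg.2 (hle e)).lt_of_ne' (sign_ne_zero.1 (left_ne_zero_of_mul he))
    rw [sign_pos hpos, one_mul]
  · exact signVector_ne_zero_iff.1 (hab.ne_zero (signVector_ne_zero_iff.2 he₀))
  · rw [sub_apply, hc, div_mul_cancel₀ _ (abs_ne_zero.2 he₀), sub_self, zero_mul]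

/-- The closed face of the cube `[-1/2, 1/2]^E` given by a sign vector `σ`: the coordinates `e` with
`σ e ≠ 0` are fixed to `± 1/2`, the others are free. In particular `cubeFace 0` is the cube. -/
def cubeFace (σ : E → SignType) : Set (EuclideanSpace ℝ E) :=
  {t | ∀ e, |t e| ≤ 1 / 2 ∧ (σ e ≠ 0 → t e = σ e / 2)}

/-- The barycentre of the face `cubeFace σ` of the cube. -/
noncomputable def cubeFaceCenter (σ : E → SignType) : EuclideanSpace ℝ E :=
  WithLp.toLp 2 fun e => (σ e : ℝ) / 2

theorem cubeFaceCenter_apply (σ : E → SignType) (e : E) : cubeFaceCenter σ e = (σ e : ℝ) / 2 :=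
  rfl

theorem cubeFaceCenter_mem (σ : E → SignType) : cubeFaceCenter σ ∈ cubeFace σ := by
  refine fun e => ⟨?_, fun _ => rfl⟩
  rw [cubeFaceCenter_apply]
  rcases (σ e).trichotomy with h | h | h <;> norm_num [h, abs_div]

theorem cubeFace_anti {σ τ : E → SignType} (h : Conforms σ τ) : cubeFace τ ⊆ cubeFace σ :=
  fun _ ht e => ⟨(ht e).1, fun he => by
    rw [(ht e).2 (h.ne_zero he), h e he]⟩

theorem cubeFace_subset_cube (σ : E → SignType) : cubeFace σ ⊆ cubeFace 0 :=
  cubeFace_anti fun _ he => absurd rfl he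

theorem convex_cubeFace (σ : E → SignType) : Convex ℝ (cubeFace σ) := by
  intro x hx y hy c d hc hd hcd e
  refine ⟨?_, fun he => ?_⟩
  · have hball := convex_closedBall (0 : ℝ) (1 / 2) (mem_closedBall_zero_iff.2 (hx e).1)
      (mem_closedBall_zero_iff.2 (hy e).1) hc hd hcd
    exact mem_closedBall_zero_iff.1 hball
  · rw [PiLp.add_apply, PiLp.smul_apply, PiLp.smul_apply, (hx e).2 he, (hy e).2 he, ← add_smul,
      hcd, one_smul]

theorem isCompact_cube : IsCompact (cubeFace (0 : E → SignType)) := by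
  have hpi := (isCompact_univ_pi fun _ : E => isCompact_closedBall (0 : ℝ) (1 / 2)).image
    (PiLp.continuous_toLp 2 fun _ : E => ℝ)
  convert hpi
  ext t
  constructor
  · exact fun ht => ⟨t.ofLp, fun e _ => mem_closedBall_zero_iff.2 (ht e).1, rfl⟩
  · rintro ⟨t, ht, rfl⟩ e
    exact ⟨mem_closedBall_zero_iff.1 (ht e trivial), fun he => absurd rfl he⟩

/-- The subspace of the vectors whose support is contained in `S`. -/
def supportedOn (S : Set E) : Submodule ℝ (EuclideanSpace ℝ E) where
  carrier := {b | ∀ e ∉ S, b e = 0}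
  zero_mem' _ _ := rfl
  add_mem' ha hb e he := by rw [PiLp.add_apply, ha e he, hb e he, add_zero]
  smul_mem' c _ ha e he := by rw [PiLp.smul_apply, ha e he, smul_zero]

theorem mul_le_abs_div_two {t : ℝ} (ht : |t| ≤ 1 / 2) (a : ℝ) : t * a ≤ |a| / 2 :=
  calc t * a ≤ |t * a| := le_abs_self _
    _ = |t| * |a| := abs_mul _ _
    _ ≤ 1 / 2 * |a| := mul_le_mul_of_nonneg_right ht (abs_nonneg _)
    _ = |a| / 2 := by ring

theorem mul_eq_abs_div_two_iff {t a : ℝ} :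
    t * a = |a| / 2 ↔ (SignType.sign a ≠ 0 → t = SignType.sign a / 2) := by
  rcases eq_or_ne a 0 with rfl | ha
  · simp
  · rw [← sign_mul_self, mul_div_right_comm, mul_left_inj' ha, imp_iff_right (sign_ne_zero.2 ha)]

variable [Fintype E]

theorem real_inner_eq_sum (x y : EuclideanSpace ℝ E) : inner ℝ x y = ∑ e, x e * y e := by
  simp only [PiLp.inner_apply, RCLike.inner_apply, conj_trivial, mul_comm]

theorem inner_le_of_mem_cubeFace {σ : E → SignType} {t : EuclideanSpace ℝ E}
    (ht : t ∈ cubeFace σ) (a : EuclideanSpace ℝ E) : inner ℝ t a ≤ ∑ e, |a e| / 2 := by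
  rw [real_inner_eq_sum]
  exact Finset.sum_le_sum fun e _ => mul_le_abs_div_two (ht e).1 _

theorem inner_eq_iff_mem_cubeFace_signVector {t a : EuclideanSpace ℝ E} (ht : t ∈ cubeFace 0) :
    inner ℝ t a = ∑ e, |a e| / 2 ↔ t ∈ cubeFace (signVector a) := by
  rw [real_inner_eq_sum, Finset.sum_eq_sum_iff_of_le fun e _ => mul_le_abs_div_two (ht e).1 _]
  simp only [Finset.mem_univ, true_imp_iff, mul_eq_abs_div_two_iff]
  exact forall_congr' fun e => (and_iff_right (ht e).1).symm

variable {W : Submodule ℝ (EuclideanSpace ℝ E)}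

/-- The orthogonal projection to `W` of the face of the cube given by a sign vector. If that is
the sign vector of an element `a` of `W`, this is the face of the zonotope of `W` where `a` is
maximal; for other sign vectors it need not be a face. -/
def zonotopeFace (W : Submodule ℝ (EuclideanSpace ℝ E)) (σ : E → SignType) :
    Set (EuclideanSpace ℝ E) :=
  W.starProjection '' cubeFace σ

/-- The zonotope of `W`: the orthogonal projection to `W` of the cube `[-1/2, 1/2]^E`. -/
def zonotope (W : Submodule ℝ (EuclideanSpace ℝ E)) : Set (EuclideanSpace ℝ E) :=
  zonotopeFace W 0

theorem zonotopeFace_anti {σ τ : E → SignType} (h : Conforms σ τ) :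
    zonotopeFace W τ ⊆ zonotopeFace W σ :=
  Set.image_mono (cubeFace_anti h)

theorem zonotopeFace_nonempty (σ : E → SignType) : (zonotopeFace W σ).Nonempty :=
  ⟨_, _, cubeFaceCenter_mem σ, rfl⟩

theorem zonotopeFace_subset (σ : E → SignType) : zonotopeFace W σ ⊆ W := by
  rintro _ ⟨t, -, rfl⟩
  exact W.starProjection_apply_mem t

theorem inner_starProjection_left (t : EuclideanSpace ℝ E) {a : EuclideanSpace ℝ E} (ha : a ∈ W) :
    inner ℝ (W.starProjection t) a = inner ℝ t a := by
  rw [W.inner_starProjection_left_eq_right, Submodule.starProjection_eq_self_iff.2 ha]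

theorem isClosed_zonotope : IsClosed (zonotope W) :=
  (isCompact_cube.image W.starProjection.continuous).isClosed

theorem convex_zonotope : Convex ℝ (zonotope W) :=
  (convex_cubeFace 0).linear_image W.starProjection.toLinearMap

theorem zonotopeFace_signVector {a : EuclideanSpace ℝ E} (ha : a ∈ W) :
    zonotopeFace W (signVector a) = {x ∈ zonotope W | inner ℝ x a = ∑ e, |a e| / 2} := by
  ext x
  constructor
  · rintro ⟨t, ht, rfl⟩
    have ht₀ := cubeFace_subset_cube _ ht
    exact ⟨⟨t, ht₀, rfl⟩, by
      rwa [inner_starProjection_left _ ha, inner_eq_iff_mem_cubeFace_signVector ht₀]⟩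
  · rintro ⟨⟨t, ht, rfl⟩, h⟩
    rw [inner_starProjection_left _ ha, inner_eq_iff_mem_cubeFace_signVector ht] at h
    exact ⟨t, h, rfl⟩

theorem inner_le_of_mem_zonotope {x a : EuclideanSpace ℝ E} (hx : x ∈ zonotope W) (ha : a ∈ W) :
    inner ℝ x a ≤ ∑ e, |a e| / 2 := by
  obtain ⟨t, ht, rfl⟩ := hx
  rw [inner_starProjection_left t ha]
  exact inner_le_of_mem_cubeFace ht a

theorem exists_mem_zonotope_inner_eq {a : EuclideanSpace ℝ E} (ha : a ∈ W) :
    ∃ y ∈ zonotope W, inner ℝ y a = ∑ e, |a e| / 2 := by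
  obtain ⟨y, hy⟩ := zonotopeFace_nonempty (W := W) (signVector a)
  rw [zonotopeFace_signVector ha] at hy
  exact ⟨y, hy⟩

theorem toExposed_zonotope (r : EuclideanSpace ℝ E) :
    (innerSL ℝ r).toExposed (zonotope W) =
      zonotopeFace W (signVector (W.starProjection r)) := by
  have ha : W.starProjection r ∈ W := W.starProjection_apply_mem r
  have inner_eq : ∀ y ∈ zonotope W, innerSL ℝ r y = inner ℝ y (W.starProjection r) := by
    intro y hy
    rw [innerSL_apply_apply, ← inner_starProjection_left r (zonotopeFace_subset _ hy),
      real_inner_comm]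
  rw [zonotopeFace_signVector ha]
  ext x
  refine and_congr_right fun hx => ⟨fun h => ?_, fun h y hy => ?_⟩
  · refine (inner_le_of_mem_zonotope hx ha).antisymm ?_
    obtain ⟨y, hy, hya⟩ := exists_mem_zonotope_inner_eq ha
    rw [← hya, ← inner_eq x hx, ← inner_eq y hy]
    exact h y hy
  · rw [inner_eq x hx, inner_eq y hy, h]
    exact inner_le_of_mem_zonotope hy ha

theorem mem_zonotope_iff {x : EuclideanSpace ℝ E} :
    x ∈ zonotope W ↔ x ∈ W ∧ ∀ a ∈ W, inner ℝ x a ≤ ∑ e, |a e| / 2 := by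
  refine ⟨fun hx => ⟨zonotopeFace_subset _ hx, fun a => inner_le_of_mem_zonotope hx⟩, ?_⟩
  rintro ⟨hxW, hx⟩
  by_contra hxZ
  obtain ⟨l, u, hlu, hux⟩ :=
    geometric_hahn_banach_closed_point convex_zonotope isClosed_zonotope hxZ
  obtain ⟨r, rfl⟩ := (InnerProductSpace.toDual ℝ (EuclideanSpace ℝ E)).surjective l
  simp only [InnerProductSpace.toDual_apply_apply] at hlu hux
  have ha : W.starProjection r ∈ W := W.starProjection_apply_mem r
  obtain ⟨y, hy, hya⟩ := exists_mem_zonotope_inner_eq ha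
  have hyu := hlu y hy
  rw [← inner_starProjection_left r (zonotopeFace_subset _ hy), real_inner_comm, hya] at hyu
  rw [← inner_starProjection_left r hxW, real_inner_comm] at hux
  exact (hux.trans_le (hx _ ha)).not_gt hyu

theorem isExposed_zonotope_iff {F : Set (EuclideanSpace ℝ E)} (hF : F.Nonempty) :
    IsExposed ℝ (zonotope W) F ↔ ∃ a ∈ W, F = zonotopeFace W (signVector a) := by
  constructor
  · intro h
    obtain ⟨l, hl⟩ := h hF
    obtain ⟨r, rfl⟩ := (InnerProductSpace.toDual ℝ (EuclideanSpace ℝ E)).surjective l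
    exact ⟨_, W.starProjection_apply_mem r, hl.trans (toExposed_zonotope r)⟩
  · rintro ⟨a, ha, rfl⟩
    rw [← Submodule.starProjection_eq_self_iff.2 ha, ← toExposed_zonotope]
    exact ContinuousLinearMap.toExposed.isExposed

theorem zonotopeFace_subset_zonotopeFace_signVector_iff {σ : E → SignType}
    {b : EuclideanSpace ℝ E} (hb : b ∈ W) :
    zonotopeFace W σ ⊆ zonotopeFace W (signVector b) ↔ Conforms (signVector b) σ := by
  refine ⟨fun hsub e he => ?_, zonotopeFace_anti⟩
  -- On a free coordinate of `cubeFace σ` the test point disagrees with the sign of `b`.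
  let τ : E → SignType := fun e => if σ e = 0 then -signVector b e else σ e
  have hτ : cubeFaceCenter τ ∈ cubeFace σ :=
    cubeFace_anti (fun e he => if_neg he) (cubeFaceCenter_mem τ)
  have hmem := hsub ⟨_, hτ, rfl⟩
  rw [zonotopeFace_signVector hb] at hmem
  have hinner := hmem.2
  rw [inner_starProjection_left _ hb,
    inner_eq_iff_mem_cubeFace_signVector (cubeFace_subset_cube _ hτ)] at hinner
  have hτb : τ e = signVector b e := by
    have h := (hinner e).2 he
    rw [cubeFaceCenter_apply, div_left_inj' two_ne_zero] at h
    rw [← sign_signType_cast (τ e), h, sign_signType_cast]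
  by_cases hσ : σ e = 0
  · rw [show τ e = -signVector b e from if_pos hσ, SignType.neg_eq_self_iff] at hτb
    exact absurd hτb he
  · rwa [show τ e = σ e from if_neg hσ] at hτb

theorem inner_eq_of_mem_zonotopeFace {σ : E → SignType} {b x : EuclideanSpace ℝ E} (hb : b ∈ W)
    (h : ∀ e, σ e = 0 → b e = 0) (hx : x ∈ zonotopeFace W σ) :
    inner ℝ x b = inner ℝ (cubeFaceCenter σ) b := by
  obtain ⟨t, ht, rfl⟩ := hx
  rw [inner_starProjection_left _ hb, real_inner_eq_sum, real_inner_eq_sum]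
  refine Finset.sum_congr rfl fun e _ => ?_
  by_cases he : σ e = 0
  · rw [h e he, mul_zero, mul_zero]
  · rw [(ht e).2 he, cubeFaceCenter_apply]

theorem mem_orthogonal_vectorSpan_zonotopeFace_iff {σ : E → SignType} {b : EuclideanSpace ℝ E}
    (hb : b ∈ W) :
    b ∈ (vectorSpan ℝ (zonotopeFace W σ))ᗮ ↔ ∀ e, σ e = 0 → b e = 0 := by
  classical
  constructor
  · intro h e he
    have hconf : Conforms σ (Function.update σ e 1) := fun e' he' =>
      Function.update_of_ne (ne_of_apply_ne σ (by rwa [he])) _ _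
    have hdiff : cubeFaceCenter (Function.update σ e 1) - cubeFaceCenter σ =
        EuclideanSpace.single e (1 / 2) := by
      ext e'
      rw [PiLp.sub_apply, cubeFaceCenter_apply, cubeFaceCenter_apply]
      rcases eq_or_ne e' e with rfl | h'
      · simp [he]
      · simp [h']
    have horth := h _ (vsub_mem_vectorSpan ℝ
      (Set.mem_image_of_mem W.starProjection (cubeFace_anti hconf (cubeFaceCenter_mem _)))
      (Set.mem_image_of_mem W.starProjection (cubeFaceCenter_mem σ)))
    rw [vsub_eq_sub, ← map_sub, hdiff, inner_starProjection_left _ hb,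
      EuclideanSpace.inner_single_left] at horth
    simpa using horth
  · intro h
    have hle : vectorSpan ℝ (zonotopeFace W σ) ≤ (ℝ ∙ b)ᗮ := by
      refine Submodule.span_le.2 ?_
      rintro _ ⟨x, hx, y, hy, rfl⟩
      refine Submodule.mem_orthogonal_singleton_iff_inner_left.2 ?_
      change inner ℝ (x - y) b = 0
      rw [inner_sub_left, inner_eq_of_mem_zonotopeFace hb h hx,
        inner_eq_of_mem_zonotopeFace hb h hy, sub_self]
    exact fun u hu => Submodule.mem_orthogonal_singleton_iff_inner_left.1 (hle hu)

theorem finrank_sub_finrank_vectorSpan_zonotopeFace (σ : E → SignType) :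
    Module.finrank ℝ W - Module.finrank ℝ (vectorSpan ℝ (zonotopeFace W σ)) =
      Module.finrank ℝ ↥(W ⊓ supportedOn {e | σ e ≠ 0}) := by
  have hle : vectorSpan ℝ (zonotopeFace W σ) ≤ W := by
    refine Submodule.span_le.2 ?_
    rintro _ ⟨x, hx, y, hy, rfl⟩
    exact W.sub_mem (zonotopeFace_subset σ hx) (zonotopeFace_subset σ hy)
  have horth : (vectorSpan ℝ (zonotopeFace W σ))ᗮ ⊓ W = W ⊓ supportedOn {e | σ e ≠ 0} := by
    ext b
    rw [inf_comm, Submodule.mem_inf, Submodule.mem_inf]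
    refine and_congr_right fun hb => (mem_orthogonal_vectorSpan_zonotopeFace_iff hb).trans ?_
    exact forall_congr' fun e => imp_congr_left not_not.symm
  rw [← horth, ← Submodule.finrank_add_inf_finrank_orthogonal hle, Nat.add_sub_cancel_left]

end Zonotopes

theorem exists_nodup_isChain_of_reflTransGen {α : Type*} {r : α → α → Prop} {a b : α}
    (h : Relation.ReflTransGen r a b) :
    ∃ l : List α, (a :: l).IsChain r ∧ (a :: l).Nodup ∧
      (a :: l).getLast (List.cons_ne_nil a l) = b := by
  induction h using Relation.ReflTransGen.head_induction_on with
  | refl => exact ⟨[], by simp⟩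
  | @head a c hac _ ih =>
    obtain ⟨l, hchain, hnodup, hlast⟩ := ih
    by_cases ha : a ∈ c :: l
    · obtain ⟨s, t, hst⟩ := List.append_of_mem ha
      simp only [hst] at hchain hnodup hlast
      refine ⟨t, hchain.right_of_append, hnodup.of_append_right, ?_⟩
      rwa [List.getLast_append_of_ne_nil _ (List.cons_ne_nil a t)] at hlast
    · exact ⟨c :: l, hchain.cons_cons hac, List.nodup_cons.2 ⟨ha, hnodup⟩, by simpa using hlast⟩

namespace OrientedMultigraph

section Circuits

variable {V E : Type*} {G : OrientedMultigraph V E}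

theorem Arc.ne_zero {σ : E → SignType} {e : E} {u v : V} (h : G.Arc σ e u v) : σ e ≠ 0 := by
  rcases h with ⟨h, -⟩ | ⟨h, -⟩ <;> simp [h]

theorem Arc.congr {σ τ : E → SignType} {e : E} {u v : V} (h : G.Arc σ e u v) (he : τ e = σ e) :
    G.Arc τ e u v := by
  simpa only [Arc, he] using h

theorem Arc.endpoints_unique {σ : E → SignType} {e : E} {u v u' v' : V} (h : G.Arc σ e u v)
    (h' : G.Arc σ e u' v') : u = u' ∧ v = v' := by
  rcases h with ⟨h, rfl, rfl⟩ | ⟨h, rfl, rfl⟩ <;> rcases h' with ⟨h', rfl, rfl⟩ | ⟨h', rfl, rfl⟩ <;>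
    first | exact ⟨rfl, rfl⟩ | (rw [h] at h'; exact absurd h' (by decide))

theorem exists_arc {σ : E → SignType} {e : E} (he : σ e ≠ 0) : ∃ u v, G.Arc σ e u v := by
  rcases (σ e).trichotomy with h | h | h
  · exact ⟨_, _, Or.inr ⟨h, rfl, rfl⟩⟩
  · exact absurd h he
  · exact ⟨_, _, Or.inl ⟨h, rfl, rfl⟩⟩

theorem exists_circuit_of_closedWalk {σ : E → SignType} {n : ℕ} {vertex : Fin (n + 1) → V}
    {edge : Fin (n + 1) → E} (hvertex : Function.Injective vertex)
    (harc : ∀ i, G.Arc σ (edge i) (vertex i) (vertex (i + 1))) :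
    ∃ C : G.OrientedCircuit, C.edges = Set.range edge ∧ Conforms C.dir σ := by
  have hedge : Function.Injective edge := fun i j hij =>
    hvertex ((harc i).endpoints_unique (hij ▸ harc j)).1
  have hsupp (e : E) : (Set.range edge).indicator σ e ≠ 0 ↔ e ∈ Set.range edge := by
    refine ⟨Set.mem_of_indicator_ne_zero, ?_⟩
    rintro ⟨i, rfl⟩
    rw [Set.indicator_of_mem (Set.mem_range_self i)]
    exact (harc i).ne_zero
  refine ⟨⟨(Set.range edge).indicator σ, n, vertex, edge, hvertex, hedge, hsupp, fun i => ?_⟩,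
    Set.ext hsupp, conforms_indicator _ _⟩
  exact (harc i).congr (Set.indicator_of_mem (Set.mem_range_self i) σ)

theorem IsStronglyConnected.exists_circuit {σ : E → SignType} (hσ : G.IsStronglyConnected σ)
    {e : E} (he : σ e ≠ 0) : ∃ C : G.OrientedCircuit, e ∈ C.edges ∧ Conforms C.dir σ := by
  obtain ⟨u, v, huv⟩ := exists_arc (G := G) he
  -- A simple directed path from the head of `e` back to its tail is closed up by `e`.
  obtain ⟨l, hchain, hnodup, hlast⟩ := exists_nodup_isChain_of_reflTransGen
    (hσ v u (.symm _ _ (.rel _ _ ⟨e, huv⟩)))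
  let vertex : Fin (l.length + 1) → V := (v :: l).get
  have hpath : ∀ i : Fin l.length, ∃ e, G.Arc σ e (vertex i.castSucc) (vertex i.succ) :=
    fun i => List.isChain_iff_getElem.1 hchain i (Nat.succ_lt_succ i.2)
  choose pathEdge hpathEdge using hpath
  let edge : Fin (l.length + 1) → E := Fin.snoc (α := fun _ => E) pathEdge e
  have harc : ∀ i, G.Arc σ (edge i) (vertex i) (vertex (i + 1)) := by
    refine Fin.lastCases ?_ fun i => ?_
    · have hvertex_last : vertex (Fin.last l.length) = u := by
        rw [← hlast, List.getLast_eq_getElem]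
        rfl
      rw [hvertex_last, Fin.last_add_one, show edge (Fin.last _) = e from Fin.snoc_last _ _]
      exact huv
    · rw [Fin.coeSucc_eq_succ, show edge i.castSucc = pathEdge i from Fin.snoc_castSucc _ _ _]
      exact hpathEdge i
  obtain ⟨C, hC, hCσ⟩ := exists_circuit_of_closedWalk (List.nodup_iff_injective_get.1 hnodup) harc
  exact ⟨C, hC ▸ ⟨Fin.last _, Fin.snoc_last _ _⟩, hCσ⟩

theorem OrientedCircuit.reverse_reachable (C : G.OrientedCircuit) {e : E} {u v : V}
    (h : G.Arc C.dir e u v) : Relation.ReflTransGen (fun a b => ∃ e, G.Arc C.dir e a b) v u := by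
  obtain ⟨n, vertex, edge, -, -, hsupp, harc⟩ := C.isCircuit
  obtain ⟨i, rfl⟩ := (hsupp e).1 h.ne_zero
  obtain ⟨rfl, rfl⟩ := h.endpoints_unique (harc i)
  have walk : ∀ k : ℕ, Relation.ReflTransGen (fun a b => ∃ e, G.Arc C.dir e a b)
      (vertex (i + 1)) (vertex (i + 1 + k • 1)) := by
    intro k
    induction k with
    | zero => rw [zero_nsmul, add_zero]
    | succ k ih =>
      rw [succ_nsmul, ← add_assoc]
      exact ih.tail ⟨_, harc _⟩
  have hn : i + 1 + n • 1 = i := by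
    have hcard := card_nsmul_eq_zero (x := (1 : Fin (n + 1)))
    rw [Fintype.card_fin] at hcard
    rw [add_assoc, ← succ_nsmul', hcard, add_zero]
  have hwalk := walk n
  rwa [hn] at hwalk

theorem isStronglyConnected_of_arc {σ : E → SignType}
    (h : ∀ e u v, G.Arc σ e u v → Relation.ReflTransGen (fun a b => ∃ e, G.Arc σ e a b) v u) :
    G.IsStronglyConnected σ := by
  have reverse : ∀ u v, Relation.ReflTransGen (fun a b => ∃ e, G.Arc σ e a b) u v →
      Relation.ReflTransGen (fun a b => ∃ e, G.Arc σ e a b) v u := by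
    intro u v huv
    induction huv with
    | refl => exact .refl
    | tail _ hbc ih =>
      obtain ⟨e, he⟩ := hbc
      exact (h e _ _ he).trans ih
  intro u v huv
  induction huv with
  | rel _ _ h => exact .single h
  | refl => exact .refl
  | symm _ _ _ ih => exact reverse _ _ ih
  | trans _ _ _ _ _ ih₁ ih₂ => exact ih₁.trans ih₂

theorem isStronglyConnected_iff_forall_exists_circuit {σ : E → SignType} :
    G.IsStronglyConnected σ ↔
      ∀ e, σ e ≠ 0 → ∃ C : G.OrientedCircuit, e ∈ C.edges ∧ Conforms C.dir σ := by
  refine ⟨fun hσ e => hσ.exists_circuit, fun h => isStronglyConnected_of_arc fun e u v huv => ?_⟩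
  obtain ⟨C, heC, hCσ⟩ := h e huv.ne_zero
  refine Relation.ReflTransGen.mono ?_ _ _ (C.reverse_reachable (huv.congr (hCσ e heC).symm))
  exact fun a b ⟨e', he'⟩ => ⟨e', he'.congr (hCσ e' he'.ne_zero)⟩

/-- An oriented circuit as an element of the poset of strongly connected orientations. -/
def OrientedCircuit.toStrong (C : G.OrientedCircuit) : G.StrongOrientation :=
  ⟨C.dir, isStronglyConnected_iff_forall_exists_circuit.2 fun _ he => ⟨C, he, fun _ _ => rfl⟩⟩

theorem StrongOrientation.le_of_forall_circuit {σ τ : G.StrongOrientation}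
    (h : ∀ C : G.OrientedCircuit, τ ≤ C.toStrong → σ ≤ C.toStrong) : σ ≤ τ := by
  intro e he
  obtain ⟨C, heC, hCτ⟩ := τ.strong.exists_circuit he
  exact (h C hCτ e heC).trans (hCτ e heC).symm

theorem OrientedCircuit.compatible_of_le {σ : G.StrongOrientation} {C D : G.OrientedCircuit}
    (hC : σ ≤ C.toStrong) (hD : σ ≤ D.toStrong) : C.Compatible D :=
  fun e heC heD => (hC e heC).symm.trans (hD e heD)

theorem StrongOrientation.edges_eq_iUnion_of_isGLB {ι : Sort*} {C : ι → G.OrientedCircuit}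
    {σ : G.StrongOrientation} (hσ : IsGLB (Set.range fun i => (C i).toStrong) σ) :
    σ.edges = ⋃ i, (C i).edges := by
  have hle (i : ι) : σ ≤ (C i).toStrong := hσ.1 ⟨i, rfl⟩
  refine Set.Subset.antisymm (fun e he => ?_) (Set.iUnion_subset fun i e he => ?_)
  · have hτC (i : ι) : Conforms (C i).dir ((⋃ i, (C i).edges).indicator σ.dir) := fun e he => by
      rw [Set.indicator_of_mem (Set.mem_iUnion_of_mem i he), hle i e he]
      rfl
    let τ : G.StrongOrientation := ⟨(⋃ i, (C i).edges).indicator σ.dir,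
      isStronglyConnected_iff_forall_exists_circuit.2 fun e he => by
        obtain ⟨i, hi⟩ := Set.mem_iUnion.1 (Set.mem_of_indicator_ne_zero he)
        exact ⟨C i, hi, hτC i⟩⟩
    have hτσ : τ ≤ σ := hσ.2 (Set.forall_mem_range.2 hτC)
    exact Set.mem_of_indicator_ne_zero ((hτσ e he).trans_ne he)
  · exact (hle i e he).trans_ne he

end Circuits

end OrientedMultigraph

namespace OrientedMultigraph

section FlowSpace

variable {V E : Type*} {G : OrientedMultigraph V E}

theorem toEuclidean_apply (a : E → ℤ) (e : E) : toEuclidean a e = a e := rfl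

theorem OrientedCircuit.toEuclidean_vec_apply (C : G.OrientedCircuit) (e : E) :
    toEuclidean C.vec e = C.dir e :=
  SignType.intCast_cast _

theorem OrientedCircuit.signVector_vec (C : G.OrientedCircuit) :
    signVector (toEuclidean C.vec) = C.dir := by
  funext e
  rw [signVector, toEuclidean_vec_apply, sign_signType_cast]

/-- The coboundary of a potential `f` on the vertices: its values are the differences of `f` along
the edges. -/
noncomputable def coboundary (G : OrientedMultigraph V E) (f : V → ℝ) : EuclideanSpace ℝ E :=
  WithLp.toLp 2 fun e => f (G.tgt e) - f (G.src e)

/-- The convex cone generated by the oriented circuits that conform to `τ`. -/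
def circuitCone (G : OrientedMultigraph V E) (τ : E → SignType) :
    PointedCone ℝ (EuclideanSpace ℝ E) :=
  PointedCone.hull ℝ {x | ∃ C : G.OrientedCircuit, Conforms C.dir τ ∧ toEuclidean C.vec = x}

theorem circuitCone_mono {σ τ : E → SignType} (h : Conforms σ τ) :
    G.circuitCone σ ≤ G.circuitCone τ :=
  Submodule.span_mono fun _ ⟨C, hC, hx⟩ => ⟨C, hC.trans h, hx⟩

theorem OrientedCircuit.vec_mem_circuitCone {C : G.OrientedCircuit} {τ : E → SignType}
    (hC : Conforms C.dir τ) : toEuclidean C.vec ∈ G.circuitCone τ :=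
  PointedCone.subset_hull ⟨C, hC, rfl⟩

theorem finrank_span_toEuclidean_image [Finite E] (L : Submodule ℤ (E → ℤ)) :
    Module.finrank ℝ (Submodule.span ℝ (toEuclidean '' (L : Set (E → ℤ)))) =
      Module.finrank ℤ L := by
  cases nonempty_fintype E
  let f : (E → ℤ) →ₗ[ℤ] EuclideanSpace ℝ E :=
    { toFun := toEuclidean
      map_add' := fun a b => by ext e; simp [toEuclidean_apply]
      map_smul' := fun c a => by ext e; simp [toEuclidean_apply] }
  have f_injective : Function.Injective f := fun a b h => funext fun e =>
    Int.cast_injective (congrArg (fun x : EuclideanSpace ℝ E => x e) h)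
  have hspan : Submodule.span ℤ (toEuclidean '' (L : Set (E → ℤ))) = L.map f :=
    (Submodule.span_image f).trans (congrArg _ L.span_eq)
  let basis := (EuclideanSpace.basisFun E ℝ).toBasis
  have hle : Submodule.span ℤ (toEuclidean '' (L : Set (E → ℤ))) ≤
      Submodule.span ℤ (Set.range basis) := by
    refine Submodule.span_le.2 ?_
    rintro _ ⟨a, -, rfl⟩
    exact basis.mem_span_iff_repr_mem ℤ _ |>.2 fun e => ⟨a e, by simp [basis, toEuclidean_apply]⟩
  have hdiscrete : DiscreteTopology (Submodule.span ℤ (toEuclidean '' (L : Set (E → ℤ)))) :=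
    DiscreteTopology.of_subset
      (inferInstanceAs (DiscreteTopology (Submodule.span ℤ (Set.range basis)))) hle
  have hfinrank := Real.finrank_eq_int_finrank_of_discrete hdiscrete
  rw [Set.finrank, Set.finrank, hspan] at hfinrank
  exact hfinrank.trans (Submodule.equivMapOfInjective f f_injective L).finrank_eq.symm

variable [Fintype E]

theorem OrientedCircuit.inner_vec_self_div_two (C : G.OrientedCircuit) :
    inner ℝ (toEuclidean C.vec) (toEuclidean C.vec) / 2 = ∑ e, |toEuclidean C.vec e| / 2 := by
  rw [real_inner_eq_sum, Finset.sum_div]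
  refine Finset.sum_congr rfl fun e _ => ?_
  rw [C.toEuclidean_vec_apply]
  rcases (C.dir e).trichotomy with h | h | h <;> simp [h]

variable [DecidableEq V]

theorem toEuclidean_mem_flowSpace {a : E → ℤ} (ha : a ∈ G.intFlows) :
    toEuclidean a ∈ G.flowSpace :=
  Submodule.subset_span ⟨a, ha, rfl⟩

theorem sum_mul_eq_of_mem_intFlows {a : E → ℤ} (ha : a ∈ G.intFlows) (f : V → ℝ) :
    ∑ e, f (G.tgt e) * a e = ∑ e, f (G.src e) * a e := by
  let S : Finset V := Finset.univ.image G.tgt ∪ Finset.univ.image G.src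
  have sum_fiberwise (g : E → V) (hg : ∀ e, g e ∈ S) :
      ∑ e, f (g e) * a e = ∑ v ∈ S, f v * ((∑ e, if g e = v then a e else 0 : ℤ) : ℝ) := by
    simp only [Int.cast_sum, Finset.mul_sum]
    rw [Finset.sum_comm]
    refine Finset.sum_congr rfl fun e _ => ?_
    simp only [Int.cast_ite, Int.cast_zero, mul_ite, mul_zero, Finset.sum_ite_eq, hg, if_true]
  rw [sum_fiberwise G.tgt (by simp [S]), sum_fiberwise G.src (by simp [S])]
  exact Finset.sum_congr rfl fun v _ => by rw [sub_eq_zero.1 (ha v)]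

theorem inner_coboundary_eq_zero {a : EuclideanSpace ℝ E} (ha : a ∈ G.flowSpace) (f : V → ℝ) :
    inner ℝ (G.coboundary f) a = 0 := by
  have hle : G.flowSpace ≤ (ℝ ∙ G.coboundary f)ᗮ := by
    refine Submodule.span_le.2 ?_
    rintro _ ⟨a, ha, rfl⟩
    refine Submodule.mem_orthogonal_singleton_iff_inner_right.2 ?_
    simp only [real_inner_eq_sum, coboundary, toEuclidean_apply, sub_mul, Finset.sum_sub_distrib]
    exact sub_eq_zero.2 (sum_mul_eq_of_mem_intFlows ha f)
  exact Submodule.mem_orthogonal_singleton_iff_inner_right.1 (hle ha)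

theorem isStronglyConnected_signVector {a : EuclideanSpace ℝ E} (ha : a ∈ G.flowSpace) :
    G.IsStronglyConnected (signVector a) := by
  classical
  refine isStronglyConnected_of_arc fun e u v he => ?_
  -- No flow leaves the set of vertices reachable from `v`, hence none enters it along `e`.
  by_contra hu
  let R : Set V := {x | Relation.ReflTransGen (fun x y => ∃ e, G.Arc (signVector a) e x y) v x}
  let f : V → ℝ := R.indicator 1
  have hmono {e : E} {x y : V} (hxy : G.Arc (signVector a) e x y) : f x ≤ f y := by
    by_cases hx : x ∈ R
    · have hy : y ∈ R := hx.tail ⟨e, hxy⟩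
      simp only [f, Set.indicator_of_mem hx, Set.indicator_of_mem hy, Pi.one_apply, le_refl]
    · simp only [f, Set.indicator_of_notMem hx]
      exact Set.indicator_nonneg (fun _ _ => zero_le_one) y
  have hnonneg : ∀ e ∈ Finset.univ, 0 ≤ (f (G.tgt e) - f (G.src e)) * a e := by
    intro e _
    rcases lt_trichotomy (a e) 0 with h | h | h
    · exact mul_nonneg_of_nonpos_of_nonpos
        (sub_nonpos.2 (hmono (Or.inr ⟨sign_neg h, rfl, rfl⟩))) h.le
    · rw [h, mul_zero]
    · exact mul_nonneg (sub_nonneg.2 (hmono (Or.inl ⟨sign_pos h, rfl, rfl⟩))) h.le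
  have hsum := inner_coboundary_eq_zero ha f
  rw [real_inner_eq_sum] at hsum
  have hzero := (Finset.sum_eq_zero_iff_of_nonneg hnonneg).1 hsum e (Finset.mem_univ e)
  have hf : f (G.tgt e) = f (G.src e) :=
    sub_eq_zero.1 ((mul_eq_zero.1 hzero).resolve_right (signVector_ne_zero_iff.1 he.ne_zero))
  have hfv : f v = 1 := Set.indicator_of_mem (s := R) .refl _
  have hfu : f u = 0 := Set.indicator_of_notMem hu _
  rcases he with ⟨-, rfl, rfl⟩ | ⟨-, rfl, rfl⟩ <;> rw [hfu, hfv] at hf <;> norm_num at hf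

theorem isStronglyConnected_iff_exists_mem_flowSpace {σ : E → SignType} :
    G.IsStronglyConnected σ ↔ ∃ a ∈ G.flowSpace, signVector a = σ := by
  classical
  refine ⟨fun hσ => ?_, fun ⟨a, ha, haσ⟩ => haσ ▸ isStronglyConnected_signVector ha⟩
  choose C heC hCσ using fun e : {e // σ e ≠ 0} => hσ.exists_circuit e.2
  refine ⟨∑ e, toEuclidean (C e).vec,
    Submodule.sum_mem _ fun e _ => toEuclidean_mem_flowSpace (C e).vec_mem,
    signVector_sum_eq (fun e _ => (C e).signVector_vec.symm ▸ hCσ e) fun e he =>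
      ⟨⟨e, he⟩, Finset.mem_univ _, ?_⟩⟩
  rw [← signVector_ne_zero_iff, (C _).signVector_vec]
  exact heC ⟨e, he⟩

theorem mem_circuitCone_signVector {b : EuclideanSpace ℝ E} (hb : b ∈ G.flowSpace) :
    b ∈ G.circuitCone (signVector b) := by
  -- Subtracting a suitable multiple of a conforming circuit makes the support of `b` smaller.
  induction hn : {e | b e ≠ 0}.ncard using Nat.strong_induction_on generalizing b with
  | _ n ih =>
    rcases eq_or_ne b 0 with rfl | hb0
    · exact Submodule.zero_mem _
    obtain ⟨e, he⟩ : ∃ e, b e ≠ 0 := by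
      by_contra! h
      exact hb0 (PiLp.ext h)
    obtain ⟨C, heC, hC⟩ :=
      (isStronglyConnected_signVector hb).exists_circuit (signVector_ne_zero_iff.2 he)
    have hC_ne : toEuclidean C.vec ≠ 0 := fun h => heC (by
      rw [← C.signVector_vec, h, signVector, PiLp.zero_apply, sign_zero])
    obtain ⟨c, hc, hconf, e₀, hbe₀, he₀⟩ :=
      exists_sub_smul_conforms (C.signVector_vec.symm ▸ hC) hC_ne
    set a := b - c • toEuclidean C.vec
    have ha_mem : a ∈ G.flowSpace :=
      sub_mem hb (Submodule.smul_mem _ _ (toEuclidean_mem_flowSpace C.vec_mem))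
    have hlt : {e | a e ≠ 0}.ncard < n := by
      rw [← hn]
      refine Set.ncard_lt_ncard ((Set.ssubset_iff_of_subset fun e hae hbe => ?_).2
        ⟨e₀, hbe₀, not_not.2 he₀⟩)
      exact signVector_ne_zero_iff.1 (hconf.ne_zero (signVector_ne_zero_iff.2 hae)) hbe
    have ha_cone : a ∈ G.circuitCone (signVector b) :=
      circuitCone_mono hconf (ih _ hlt ha_mem rfl)
    have hC_cone := PointedCone.smul_mem _ hc (OrientedCircuit.vec_mem_circuitCone hC)
    simpa only [a, sub_add_cancel] using Submodule.add_mem _ ha_cone hC_cone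

theorem StrongOrientation.span_toEuclidean_flows (σ : G.StrongOrientation) :
    Submodule.span ℝ (toEuclidean '' (σ.flows : Set (E → ℤ))) =
      G.flowSpace ⊓ supportedOn {e | σ.dir e ≠ 0} := by
  apply le_antisymm
  · refine Submodule.span_le.2 ?_
    rintro _ ⟨a, ha, rfl⟩
    exact ⟨toEuclidean_mem_flowSpace ha.1, fun e he => by
      rw [toEuclidean_apply, ha.2 e he, Int.cast_zero]⟩
  · rintro b ⟨hb, hbσ⟩
    refine Submodule.span_le.2 ?_ (PointedCone.hull_le_span ℝ _ (mem_circuitCone_signVector hb))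
    rintro _ ⟨C, hC, rfl⟩
    refine Submodule.subset_span ⟨C.vec, ⟨C.vec_mem, fun e he => ?_⟩, rfl⟩
    by_contra hCe
    have hCe' : C.dir e ≠ 0 := fun h => hCe (by rw [OrientedCircuit.vec, h, SignType.coe_zero])
    exact signVector_ne_zero_iff.1 (hC.ne_zero hCe') (hbσ e he)

theorem StrongOrientation.genus_eq_finrank (σ : G.StrongOrientation) :
    σ.genus = Module.finrank ℝ ↥(G.flowSpace ⊓ supportedOn {e | σ.dir e ≠ 0}) := by
  rw [genus, ← σ.span_toEuclidean_flows, finrank_span_toEuclidean_image]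

end FlowSpace

section VoronoiCell

variable {V E : Type*} [DecidableEq V] [Fintype E] {G : OrientedMultigraph V E}

theorem inner_le_inner_cubeFaceCenter {x : EuclideanSpace ℝ E} (hx : x ∈ G.voronoiCell)
    {τ : E → SignType} {a : EuclideanSpace ℝ E} (ha : a ∈ G.circuitCone τ) :
    inner ℝ x a ≤ inner ℝ (cubeFaceCenter τ) a := by
  induction ha using Submodule.span_induction with
  | mem _ h =>
    obtain ⟨C, hC, rfl⟩ := h
    have hτ : cubeFaceCenter τ ∈ cubeFace (signVector (toEuclidean C.vec)) :=
      cubeFace_anti (C.signVector_vec.symm ▸ hC) (cubeFaceCenter_mem τ)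
    rw [(inner_eq_iff_mem_cubeFace_signVector (cubeFace_subset_cube _ hτ)).2 hτ,
      ← C.inner_vec_self_div_two]
    exact (dist_zero_le_iff _ _).1 (hx.2 _ C.vec_mem)
  | zero => rw [inner_zero_right, inner_zero_right]
  | add a b _ _ iha ihb =>
    rw [inner_add_right, inner_add_right]
    exact add_le_add iha ihb
  | smul c a _ ih =>
    rw [show c • a = (c : ℝ) • a from rfl, real_inner_smul_right, real_inner_smul_right]
    exact mul_le_mul_of_nonneg_left ih c.2

theorem sum_abs_toEuclidean_div_two_le (a : E → ℤ) :
    ∑ e, |toEuclidean a e| / 2 ≤ inner ℝ (toEuclidean a) (toEuclidean a) / 2 := by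
  rw [real_inner_eq_sum, Finset.sum_div]
  refine Finset.sum_le_sum fun e _ => div_le_div_of_nonneg_right ?_ zero_le_two
  rw [toEuclidean_apply, ← sq, ← sq_abs]
  exact_mod_cast Int.le_self_sq |a e|

theorem voronoiCell_eq_zonotope (G : OrientedMultigraph V E) :
    G.voronoiCell = zonotope G.flowSpace := by
  ext x
  rw [mem_zonotope_iff]
  refine and_congr_right fun hxW => ⟨fun hx a ha => ?_, fun hx a ha => ?_⟩
  · exact (inner_le_inner_cubeFaceCenter ⟨hxW, hx⟩ (mem_circuitCone_signVector ha)).trans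
      (inner_le_of_mem_cubeFace (cubeFaceCenter_mem _) a)
  · exact (dist_zero_le_iff _ _).2
      ((hx _ (toEuclidean_mem_flowSpace ha)).trans (sum_abs_toEuclidean_div_two_le a))

end VoronoiCell

section AminiIso

variable {V E : Type*} [DecidableEq V] [Fintype E] {G : OrientedMultigraph V E}

/-- The face of the Voronoi cell corresponding to a strongly connected orientation: the projection
to the flow space of the face of the cube with the same sign vector. -/
def StrongOrientation.face (σ : G.StrongOrientation) : G.VoronoiFace :=
  ⟨zonotopeFace G.flowSpace σ.dir, zonotopeFace_nonempty _, by
    obtain ⟨a, ha, haσ⟩ := isStronglyConnected_iff_exists_mem_flowSpace.1 σ.strong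
    rw [voronoiCell_eq_zonotope, ← haσ]
    exact (isExposed_zonotope_iff (zonotopeFace_nonempty _)).2 ⟨a, ha, rfl⟩⟩

theorem StrongOrientation.face_le_face_iff {σ τ : G.StrongOrientation} :
    σ.face ≤ τ.face ↔ σ ≤ τ := by
  obtain ⟨b, hb, hbτ⟩ := isStronglyConnected_iff_exists_mem_flowSpace.1 τ.strong
  change zonotopeFace _ σ.dir ⊆ zonotopeFace _ τ.dir ↔ Conforms τ.dir σ.dir
  rw [← hbτ, zonotopeFace_subset_zonotopeFace_signVector_iff hb]

theorem StrongOrientation.face_surjective :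
    Function.Surjective (face : G.StrongOrientation → G.VoronoiFace) := by
  rintro ⟨F, hne, hF⟩
  rw [voronoiCell_eq_zonotope, isExposed_zonotope_iff hne] at hF
  obtain ⟨a, ha, rfl⟩ := hF
  exact ⟨⟨signVector a, isStronglyConnected_signVector ha⟩, rfl⟩

theorem StrongOrientation.faceCodim_face (σ : G.StrongOrientation) :
    faceCodim σ.face = σ.genus :=
  (finrank_sub_finrank_vectorSpan_zonotopeFace σ.dir).trans σ.genus_eq_finrank.symm

theorem OrientedCircuit.face_toStrong (C : G.OrientedCircuit) : C.toStrong.face = C.facet := by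
  refine Subtype.ext ?_
  change zonotopeFace G.flowSpace C.dir = C.facetSet
  rw [← C.signVector_vec, zonotopeFace_signVector (toEuclidean_mem_flowSpace C.vec_mem),
    ← C.inner_vec_self_div_two, ← voronoiCell_eq_zonotope]
  rfl

/-- Amini's isomorphism, the inverse of `StrongOrientation.face`. -/
noncomputable def aminiIso (G : OrientedMultigraph V E) : G.VoronoiFace ≃o G.StrongOrientation :=
  (RelIso.ofSurjective (OrderEmbedding.ofMapLEIff StrongOrientation.face
    fun _ _ => StrongOrientation.face_le_face_iff) StrongOrientation.face_surjective).symm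

theorem aminiIso_face (σ : G.StrongOrientation) : G.aminiIso σ.face = σ :=
  G.aminiIso.apply_symm_apply σ

theorem isAminiIso_aminiIso (G : OrientedMultigraph V E) : IsAminiIso G.aminiIso := by
  refine ⟨fun F => ?_, fun C => ?_⟩
  · obtain ⟨σ, rfl⟩ := StrongOrientation.face_surjective F
    rw [aminiIso_face, σ.faceCodim_face]
  · rw [← C.face_toStrong, aminiIso_face]
    rfl

theorem IsAminiIso.apply_facet {Φ : G.VoronoiFace ≃o G.StrongOrientation} (hΦ : IsAminiIso Φ)
    (C : G.OrientedCircuit) : Φ C.facet = C.toStrong :=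
  StrongOrientation.ext (hΦ.2 C)

theorem IsAminiIso.le_of_isAminiIso {Φ Ψ : G.VoronoiFace ≃o G.StrongOrientation}
    (hΦ : IsAminiIso Φ) (hΨ : IsAminiIso Ψ) (F : G.VoronoiFace) : Φ F ≤ Ψ F := by
  refine StrongOrientation.le_of_forall_circuit fun C hC => ?_
  rw [← hΨ.apply_facet, Ψ.le_iff_le] at hC
  rwa [← hΦ.apply_facet, Φ.le_iff_le]

theorem IsAminiIso.unique {Φ Ψ : G.VoronoiFace ≃o G.StrongOrientation} (hΦ : IsAminiIso Φ)
    (hΨ : IsAminiIso Ψ) : Φ = Ψ :=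
  RelIso.ext fun F => (hΦ.le_of_isAminiIso hΨ F).antisymm (hΨ.le_of_isAminiIso hΦ F)

theorem IsAminiIso.isGLB_of_eq_iInter {Φ : G.VoronoiFace ≃o G.StrongOrientation}
    (hΦ : IsAminiIso Φ) {ι : Sort*} {C : ι → G.OrientedCircuit} {F : G.VoronoiFace}
    (hF : (F : Set (EuclideanSpace ℝ E)) = ⋂ i, ((C i).facet : Set (EuclideanSpace ℝ E))) :
    IsGLB (Set.range fun i => (C i).toStrong) (Φ F) := by
  have hglb : IsGLB (Set.range fun i => (C i).facet) F := by
    refine ⟨Set.forall_mem_range.2 fun i => hF.subset.trans (Set.iInter_subset _ i),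
      fun D hD => ?_⟩
    exact (Set.subset_iInter fun i => hD ⟨i, rfl⟩ : D.1 ⊆ _).trans hF.superset
  rw [← Φ.isGLB_image', ← Set.range_comp] at hglb
  simpa only [Function.comp_def, hΦ.apply_facet] using hglb

end AminiIso

end OrientedMultigraph

open OrientedMultigraph in
theorem mainTheorem5_general {V E : Type*} [DecidableEq V] [Fintype E]
    (G : OrientedMultigraph V E) :
    (∃! Φ : G.VoronoiFace ≃o G.StrongOrientation, IsAminiIso Φ) ∧
    ∀ {ι : Sort*} (C : ι → G.OrientedCircuit) (F : G.VoronoiFace),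
      (F : Set (EuclideanSpace ℝ E)) = ⋂ i, ((C i).facet : Set (EuclideanSpace ℝ E)) →
      (∀ i j, (C i).Compatible (C j)) ∧
      ∀ Φ : G.VoronoiFace ≃o G.StrongOrientation, IsAminiIso Φ →
        (Φ F).edges = ⋃ i, (C i).edges ∧
        ∀ i, ∀ e ∈ (C i).edges, (Φ F).dir e = (C i).dir e := by
  refine ⟨⟨G.aminiIso, isAminiIso_aminiIso G, fun Ψ hΨ => hΨ.unique (isAminiIso_aminiIso G)⟩,
    fun C F hF => ⟨fun i j => ?_, fun Φ hΦ => ?_⟩⟩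
  · have hglb := (isAminiIso_aminiIso G).isGLB_of_eq_iInter hF
    exact OrientedCircuit.compatible_of_le (hglb.1 ⟨i, rfl⟩) (hglb.1 ⟨j, rfl⟩)
  · have hglb := hΦ.isGLB_of_eq_iInter hF
    exact ⟨StrongOrientation.edges_eq_iUnion_of_isGLB hglb, fun i => hglb.1 ⟨i, rfl⟩⟩

theorem mainTheorem5 {V E : Type*} [Fintype V] [DecidableEq V] [Fintype E]
    (G : OrientedMultigraph V E) :
    (∃! Φ : G.VoronoiFace ≃o G.StrongOrientation, OrientedMultigraph.IsAminiIso Φ) ∧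
    ∀ (s : ℕ) (C : Fin s → G.OrientedCircuit) (F : G.VoronoiFace),
      (F : Set (EuclideanSpace ℝ E)) = ⋂ i, ((C i).facet : Set (EuclideanSpace ℝ E)) →
      (∀ i j, (C i).Compatible (C j)) ∧
      ∀ Φ : G.VoronoiFace ≃o G.StrongOrientation, OrientedMultigraph.IsAminiIso Φ →
        (Φ F).edges = ⋃ i, (C i).edges ∧
        ∀ i, ∀ e ∈ (C i).edges, (Φ F).dir e = (C i).dir e :=
  (mainTheorem5_general G).imp_right fun h _ C F hF => h C F hF
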